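/- Let $p$ be a prime, let $R$ be an $F$-finite regular domain of characteristic $p$, and let $\mathfrak a,\mathfrak b$ be nonzero proper ideals of $R$ with $\mathfrak a\subseteq\sqrt{\mathfrak b}$. Throughout, $q$ denotes a power $p^e$, $e\ge 0$. Notation. For an ideal $\mathfrak c$ of $R$, put $\mathfrak c^{[q]}=\langle f^q: f\in\mathfrak c\rangle$. For $k\in\mathbb N$ with base $p$ expansion $k=k_0+k_1p+\cdots+k_rp^r$, put $\mathfrak c^{[k]}=\mathfrak c^{k_0}(\mathfrak c^{k_1})^{[p]}\cdots(\mathfrak c^{k_r})^{[p^r]}$. Let $\mathfrak c^{[1/q]}$ be the smallest ideal $\mathfrak d$ with $\mathfrak c\subseteq\mathfrak d^{[q]}$, and $\mathfrak c^{[k/q]}=(\mathfrak c^{[k]})^{[1/q]}$. For nonzero $\mathfrak c$ and real $t\ge0$, let $\mathfrak c^{[t]}$ be the union of the ascending family of ideals $\mathfrak c^{[k/q]}$ over all $k/q\ge t$ (equivalently, over any sequence of such numbers decreasing to $t$). For a nonzero ideal $\mathfrak c\subseteq\sqrt{\mathfrak b}$ put $$\nu_{\mathfrak c}^{\mathfrak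 b}(q)=\max\{k\in\mathbb N:\mathfrak c^k\not\subseteq\mathfrak b^{[q]}\},\qquad \mu_{\mathfrak c}^{\mathfrak b}(q)=\max\{k\in\mathbb N:\mathfrak c^{[k]}\not\subseteq\mathfrak b^{[q]}\},$$ $$\mathrm{ft}^{\mathfrak b}(\mathfrak c)=\sup_q\frac{\nu_{\mathfrak c}^{\mathfrak b}(q)}q,\qquad \mathrm{crit}^{\mathfrak b}(\mathfrak c)=\sup_q\frac{\mu_{\mathfrak c}^{\mathfrak b}(q)}q,$$ and write $\mathrm{ft}^{\mathfrak b}(f)$, $\mathrm{crit}^{\mathfrak b}(f)$ when $\mathfrak c=\langle f\rangle$. Proposition. The maxima defining $\nu_{\mathfrak a}^{\mathfrak b}(q)$ and $\mu_{\mathfrak a}^{\mathfrak b}(q)$ exist for every $q$, and $\mathrm{ft}^{\mathfrak b}(\mathfrak a)=\lim_{q\to\infty}\nu_{\mathfrak a}^{\mathfrak b}(q)/q$, $\mathrm{crit}^{\mathfrak b}(\mathfrak a)=\lim_{q\to\infty}\mu_{\mathfrak a}^{\mathfrak b}(q)/q$. Moreover: (1) If $f$ is a nonzero element of $\mathfrak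 a$, then $0<\mathrm{ft}^{\mathfrak b}(f)=\mathrm{crit}^{\mathfrak b}(f)\le\mathrm{crit}^{\mathfrak b}(\mathfrak a)\le\mathrm{ft}^{\mathfrak b}(\mathfrak a)<\infty$. (2) $\mathrm{crit}^{\mathfrak b}(\mathfrak a)=\sup\{i/q: i\in\mathbb N,\ q=p^e,\ \mathfrak a^{[i]}\not\subseteq\mathfrak b^{[q]}\}=\inf\{i/q: i\in\mathbb N,\ q=p^e,\ \mathfrak a^{[i]}\subseteq\mathfrak b^{[q]}\}$. (3) $\mathrm{crit}^{\mathfrak b}(\mathfrak a)=\sup\{t\in\mathbb R_{\ge0}:\mathfrak a^{[t]}\not\subseteq\mathfrak b\}=\min\{t\in\mathbb R_{\ge0}:\mathfrak a^{[t]}\subseteq\mathfrak b\}$. (4) For every $q$, $\mu_{\mathfrak a}^{\mathfrak b}(q)<q\cdot\mathrm{crit}^{\mathfrak b}(\mathfrak a)\le\mu_{\mathfrak a}^{\mathfrak b}(q)+1$, so that $\mu_{\mathfrak a}^{\mathfrak b}(q)=\lceil q\cdot\mathrm{crit}^{\mathfrak b}(\mathfrak a)\rceil-1$. -/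

import Mathlib

open Set Filter Topology
open scoped NNReal ENNReal

namespace FrobeniusPowers

variable {R : Type*} [CommRing R]

/-- The standard Frobenius power `𝔞^[q] = ⟨f ^ q : f ∈ 𝔞⟩` (used only when `q` is a power of the
characteristic). -/
def bracketPow (a : Ideal R) (q : ℕ) : Ideal R :=
  Ideal.span ((fun f : R => f ^ q) '' (a : Set R))

/-- The integral (generalized) Frobenius power
`𝔞^[k] = 𝔞^{k₀} · (𝔞^{k₁})^[p] ⋯ (𝔞^{k_r})^[p^r]`, where `k = k₀ + k₁ p + ⋯ + k_r p^r` is the base `p`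
expansion. The `j`-th digit is `k / p ^ j % p`; the digits with `j > k` vanish, and they would
contribute only unit factors. -/
def intPow (p : ℕ) (a : Ideal R) (k : ℕ) : Ideal R :=
  ∏ j ∈ Finset.range (k + 1), bracketPow (a ^ (k / p ^ j % p)) (p ^ j)

/-- The ideal `𝔞^[1/q]`: the smallest ideal `𝔠` with `𝔞 ⊆ 𝔠^[q]`. (A smallest one exists when `R` is
an `F`-finite regular domain, and it is then the intersection of all such `𝔠`.) -/
def rootPow (a : Ideal R) (q : ℕ) : Ideal R :=
  sInf {c : Ideal R | a ≤ bracketPow c q}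

/-- The `p`-rational Frobenius power `𝔞^[k/p^e] = (𝔞^[k])^[1/p^e]`. -/
def ratPow (p : ℕ) (a : Ideal R) (k e : ℕ) : Ideal R :=
  rootPow (intPow p a k) (p ^ e)

/-- The real Frobenius power `𝔞^[t]`: the union of the ascending family of the ideals `𝔞^[c]`, for
`c = k/p^e` a `p`-rational number approximating `t` from above (`c ≥ t`). Since `𝔞^[c]` increases as
`c` decreases, this is also the union of the `𝔞^[t_k]` along any one sequence of `p`-rational numbers
`t_k` decreasing to `t`. -/
def realPow (p : ℕ) (a : Ideal R) (t : ℝ≥0) : Ideal R :=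
  ⨆ (k : ℕ) (e : ℕ) (_ : t ≤ (k : ℝ≥0) / (p : ℝ≥0) ^ e), ratPow p a k e

/-- `ν_𝔞^𝔟(q) = max {k : 𝔞^k ⊄ 𝔟^[q]}`. -/
noncomputable def nu (a b : Ideal R) (q : ℕ) : ℕ :=
  sSup {k : ℕ | ¬ a ^ k ≤ bracketPow b q}

/-- `μ_𝔞^𝔟(q) = max {k : 𝔞^[k] ⊄ 𝔟^[q]}`. -/
noncomputable def mu (p : ℕ) (a b : Ideal R) (q : ℕ) : ℕ :=
  sSup {k : ℕ | ¬ intPow p a k ≤ bracketPow b q}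

/-- The `F`-threshold of `𝔞` with respect to `𝔟`, an element of `[0, ∞]`:
the supremum of `ν_𝔞^𝔟(q) / q` over all powers `q = p ^ e`. -/
noncomputable def ft (p : ℕ) (a b : Ideal R) : ℝ≥0∞ :=
  ⨆ e : ℕ, (nu a b (p ^ e) : ℝ≥0∞) / (p : ℝ≥0∞) ^ e

/-- The critical Frobenius exponent of `𝔞` with respect to `𝔟`, an element of `[0, ∞]`:
the supremum of `μ_𝔞^𝔟(q) / q` over all powers `q = p ^ e`. -/
noncomputable def crit (p : ℕ) (a b : Ideal R) : ℝ≥0∞ :=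
  ⨆ e : ℕ, (mu p a b (p ^ e) : ℝ≥0∞) / (p : ℝ≥0∞) ^ e

end FrobeniusPowers

/-! Everything rests on flatness of Frobenius (Kunz, `IsRegularRing.flat_frobenius`), proved locally
by induction on the number of generators of the maximal ideal. By `F`-finiteness flat becomes
projective, so `R` has a finite dual basis over its `q`-th powers, whose maps `φ i` detect
membership in `c^[q]` (`mem_bracketPow_iff`). Hence Frobenius roots exist, `c ↦ c^[q]` reflects
inclusion, and `(d^[q] : u^q) = (d : u)^[q]`.

Taking Frobenius powers of `a^[μ(q)+1] ⊆ b^[q]` gives `μ(qq') < (μ(q)+1)q'`, and reflecting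
inclusions gives `μ(q)p ≤ μ(qp)`. So `μ(q)/q` increases and `crit ≤ (μ(q)+1)/q`. Moreover `μ(q)/q <
crit` (`exists_mu_mul_pow_lt`): otherwise a nonzero element of `a` would lie in all powers of a
proper colon ideal, against Krull's intersection theorem. The two bounds make `crit ≤ k/q`
equivalent to `a^[k] ⊆ b^[q]` (`crit_le_div_pow_iff`), the source of the sup, inf, real-exponent and
ceiling descriptions. -/

namespace IsRegularLocalRing

/-! ### Regular local rings are domains. -/

open IsLocalRing

/-- The quotient of a regular local ring by an element of `𝔪 \ 𝔪²` is regular, and its maximal ideal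
needs one generator less. -/
theorem quotient_span_singleton {R : Type*} [CommRing R] [IsRegularLocalRing R] {x : R}
    (hx : x ∈ maximalIdeal R) (hx2 : x ∉ maximalIdeal R ^ 2) :
    ∃ _ : IsRegularLocalRing (R ⧸ Ideal.span {x}),
      (maximalIdeal (R ⧸ Ideal.span {x})).spanFinrank + 1 = (maximalIdeal R).spanFinrank := by
  classical
  obtain ⟨s, hcard, hs⟩ :=
    Submodule.FG.exists_span_finset_card_eq_spanFinrank (maximalIdeal R).fg_of_isNoetherianRing
  have hne : Ideal.span {x} ≠ ⊤ := fun h =>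
    (maximalIdeal.isMaximal R).ne_top (top_le_iff.1 (h ▸ (Ideal.span_singleton_le_iff_mem _).2 hx))
  have : Nontrivial (R ⧸ Ideal.span {x}) := Ideal.Quotient.nontrivial_iff.2 hne
  have hsurj := Ideal.Quotient.mk_surjective (I := Ideal.span {x})
  have : IsLocalRing (R ⧸ Ideal.span {x}) := .of_surjective' _ hsurj
  have hmap : maximalIdeal (R ⧸ Ideal.span {x}) =
      (maximalIdeal R).map (Ideal.Quotient.mk (Ideal.span {x})) := by
    have := Ideal.comap_isMaximal_of_surjective _ hsurj (K := maximalIdeal (R ⧸ Ideal.span {x}))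
    rw [← eq_maximalIdeal this, Ideal.map_comap_of_surjective _ hsurj]
  obtain ⟨c, hc⟩ : ∃ c : R → R, ∑ g ∈ s, c g • g = x :=
    Submodule.mem_span_finset'.1 (hs ▸ hx) |>.elim fun c hc =>
      ⟨fun r => if h : r ∈ s then c ⟨r, h⟩ else 0, by
        rw [← hc, ← Finset.sum_coe_sort]; simp⟩
  have hsm : ∀ g ∈ s, g ∈ maximalIdeal R := fun g hg => hs ▸ Submodule.subset_span hg
  -- As `x ∉ 𝔪²`, some coefficient is a unit, so `x` can replace `g` in the minimal generating set.
  obtain ⟨g, hg, hu⟩ : ∃ g ∈ s, IsUnit (c g) := by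
    by_contra! h
    refine hx2 (hc ▸ sum_mem fun g hg => ?_)
    rw [pow_two]
    exact Ideal.mul_mem_mul (h g hg) (hsm g hg)
  have hle : (maximalIdeal (R ⧸ Ideal.span {x})).spanFinrank + 1 ≤ (maximalIdeal R).spanFinrank := by
    have hspan : maximalIdeal (R ⧸ Ideal.span {x}) =
        Ideal.span ((s.erase g).image (Ideal.Quotient.mk (Ideal.span {x})) : Set _) := by
      rw [hmap, Finset.coe_image, ← Ideal.map_span]
      refine le_antisymm ?_ (Ideal.map_mono (Ideal.span_le.2 fun y hy => hsm y
        (Finset.mem_of_mem_erase hy)))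
      conv_lhs => rw [← hs]
      change Ideal.map _ (Ideal.span _) ≤ _
      rw [Ideal.map_span, Ideal.span_le]
      rintro _ ⟨y, hy, rfl⟩
      rcases eq_or_ne y g with rfl | hyg
      · have h0 := congrArg (Ideal.Quotient.mk (Ideal.span {x})) hc
        rw [Ideal.Quotient.eq_zero_iff_mem.2 (Ideal.mem_span_singleton_self x),
          ← Finset.add_sum_erase _ _ hg, map_add, smul_eq_mul, map_mul] at h0
        refine (Ideal.unit_mul_mem_iff_mem _ (hu.map (Ideal.Quotient.mk (Ideal.span {x})))).1 ?_
        rw [eq_neg_of_add_eq_zero_left h0]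
        refine neg_mem (Ideal.mem_map_of_mem _ (sum_mem fun z hz => ?_))
        exact Ideal.mul_mem_left _ _ (Ideal.subset_span hz)
      · exact Ideal.mem_map_of_mem _ (Ideal.subset_span (Finset.mem_erase.2 ⟨hyg, hy⟩))
    rw [hspan, ← hcard, ← Finset.card_erase_add_one hg]
    gcongr
    exact (Submodule.spanFinrank_span_le_ncard_of_finite (Finset.finite_toSet _)).trans
      (by rw [Set.ncard_coe_finset]; exact Finset.card_image_le)
  have hdim : ringKrullDim R ≤ ringKrullDim (R ⧸ Ideal.span {x}) + 1 := by
    simpa using ringKrullDim_le_ringKrullDim_quotient_add_encard {x}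
      (by simpa [IsLocalRing.ringJacobson_eq_maximalIdeal] using hx)
  rw [← (isRegularLocalRing_iff R).1 ‹_›] at hdim
  have hreg := ringKrullDim_le_spanFinrank_maximalIdeal (R ⧸ Ideal.span {x})
  have hge : (maximalIdeal R).spanFinrank ≤ (maximalIdeal (R ⧸ Ideal.span {x})).spanFinrank + 1 := by
    exact_mod_cast hdim.trans (add_le_add_left hreg 1)
  have heq := le_antisymm hle hge
  refine ⟨.of_spanFinrank_maximalIdeal_le _ ?_, heq⟩
  rw [← heq, Nat.cast_add, Nat.cast_one] at hdim
  exact ENat.WithBot.add_le_add_one_right_iff.1 hdim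

/-- Prime avoidance tolerates the non-prime `𝔪²`. Containment of `𝔪` in `𝔪²` is excluded by
Nakayama, in a minimal prime by height. -/
theorem exists_notMem_sq {R : Type*} [CommRing R] [IsRegularLocalRing R]
    (h : (maximalIdeal R).spanFinrank ≠ 0) :
    ∃ x ∈ maximalIdeal R, x ∉ maximalIdeal R ^ 2 ∧ ∀ q ∈ minimalPrimes R, x ∉ q := by
  by_contra! H
  have hsub : (maximalIdeal R : Set R) ⊆
      ⋃ q ∈ insert (maximalIdeal R ^ 2) (minimalPrimes R), ((q : Ideal R) : Set R) := by
    intro x hx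
    by_cases hx2 : x ∈ maximalIdeal R ^ 2
    · exact Set.mem_biUnion (Set.mem_insert _ _) hx2
    · obtain ⟨q, hq, hxq⟩ := H x hx hx2
      exact Set.mem_biUnion (Set.mem_insert_of_mem _ hq) hxq
  obtain ⟨q, hq, hle⟩ := (Ideal.subset_union_prime_finite
    (((⊥ : Ideal R).finite_minimalPrimes_of_isNoetherianRing).insert (maximalIdeal R ^ 2))
    (f := id) (maximalIdeal R ^ 2) (maximalIdeal R ^ 2)
    (fun i hi hne _ => ((Set.mem_insert_iff.1 hi).resolve_left hne).1.1)).1 hsub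
  rcases Set.mem_insert_iff.1 hq with rfl | hq
  · refine h ((Submodule.spanFinrank_eq_zero_iff_eq_bot (maximalIdeal R).fg_of_isNoetherianRing).2
      (Submodule.eq_bot_of_le_smul_of_le_jacobson_bot (maximalIdeal R) _
        (maximalIdeal R).fg_of_isNoetherianRing ?_ (maximalIdeal_le_jacobson _)))
    simpa [pow_two] using hle
  · have hq' : q.IsPrime := hq.1.1
    have : q = maximalIdeal R := le_antisymm (le_maximalIdeal hq'.ne_top) hle
    subst this
    have h0 := Ideal.height_eq_zero_iff.2 hq
    have h1 := maximalIdeal_height_eq_ringKrullDim (R := R)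
    rw [h0, ← (isRegularLocalRing_iff R).1 ‹_›] at h1
    exact h (by exact_mod_cast h1.symm)

/-- A regular local ring is a domain. -/
theorem isDomain (R : Type*) [CommRing R] [IsRegularLocalRing R] : IsDomain R := by
  induction hn : (maximalIdeal R).spanFinrank generalizing R with
  | zero =>
    have hbot := (Submodule.spanFinrank_eq_zero_iff_eq_bot
      (maximalIdeal R).fg_of_isNoetherianRing).1 hn
    exact (isField_iff_maximalIdeal_eq.2 hbot).isDomain
  | succ n ih =>
    obtain ⟨x, hx, hx2, hxq⟩ := exists_notMem_sq (R := R) (by lia)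
    obtain ⟨_, hrank⟩ := quotient_span_singleton hx hx2
    have := ih (R ⧸ Ideal.span {x}) (by lia)
    have hprime : (Ideal.span {x}).IsPrime := (Ideal.Quotient.isDomain_iff_prime _).1 this
    obtain ⟨q, hq, hqx⟩ := Ideal.exists_minimalPrimes_le (bot_le : ⊥ ≤ Ideal.span {x})
    have hq' : q.IsPrime := hq.1.1
    -- Since `q ⊆ (x)` and `x ∉ q`, primality gives `q = xq`; Nakayama kills `q`.
    have hq0 : q = ⊥ := by
      refine Submodule.eq_bot_of_le_smul_of_le_jacobson_bot (Ideal.span {x}) _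
        q.fg_of_isNoetherianRing (fun y hy => ?_)
        (((Ideal.span_singleton_le_iff_mem _).2 hx).trans (maximalIdeal_le_jacobson _))
      obtain ⟨z, rfl⟩ := Ideal.mem_span_singleton.1 (hqx hy)
      exact Submodule.smul_mem_smul (Ideal.mem_span_singleton_self x)
        ((hq'.mem_or_mem hy).resolve_left (hxq q hq))
    subst hq0
    exact IsDomain.of_bot_isPrime R

end IsRegularLocalRing

/-! ### The Frobenius pushforward and its bases. -/

/-- The Frobenius pushforward `F_* R`: the additive group of `R`, where `r` acts as multiplication
by `r ^ p`. -/
def FrobeniusPushforward (_p : ℕ) (R : Type*) : Type _ := R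

namespace FrobeniusPushforward

open IsLocalRing

variable {R : Type*} [CommRing R] (p : ℕ)

instance : AddCommGroup (FrobeniusPushforward p R) := inferInstanceAs (AddCommGroup R)

instance [ExpChar R p] : Module R (FrobeniusPushforward p R) :=
  Module.compHom R (frobenius R p)

/-- An element of `R`, seen in the Frobenius pushforward. -/
def of : R ≃+ FrobeniusPushforward p R := AddEquiv.refl R

theorem smul_of [ExpChar R p] (r s : R) : r • of p s = of p (r ^ p * s) := rfl

theorem flat_iff [ExpChar R p] :
    (frobenius R p).Flat ↔ Module.Flat R (FrobeniusPushforward p R) := Iff.rfl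

theorem finite_iff [ExpChar R p] :
    (frobenius R p).Finite ↔ Module.Finite R (FrobeniusPushforward p R) := Iff.rfl

/-- The `x`-adic expansion: reapply `h` to the remainder `s`. -/
theorem exists_sum_add_pow_mul {R ι : Type*} [CommRing R] [Fintype ι] {x : R} {e : ι → R}
    (h : ∀ r, ∃ (c : ι → R) (s : R), r = ∑ j, c j ^ p * e j + x * s) (k : ℕ) (r : R) :
    ∃ (c : ℕ → ι → R) (s : R),
      r = ∑ i ∈ Finset.range k, x ^ i * ∑ j, c i j ^ p * e j + x ^ k * s := by
  induction k generalizing r with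
  | zero => exact ⟨0, r, by simp⟩
  | succ k ih =>
    obtain ⟨c, s, rfl⟩ := ih r
    obtain ⟨d, t, rfl⟩ := h s
    refine ⟨fun i => if i = k then d else c i, t, ?_⟩
    have hsum : ∑ i ∈ Finset.range k, x ^ i * ∑ j, (if i = k then d else c i) j ^ p * e j =
        ∑ i ∈ Finset.range k, x ^ i * ∑ j, c i j ^ p * e j :=
      Finset.sum_congr rfl fun i hi => by rw [if_neg (Finset.mem_range.1 hi).ne]
    simp only [Finset.sum_range_succ, if_true, hsum]
    ring

/-- Once `x` divides the `c 0 j`, their `p`-th powers vanish modulo `x ^ k` because `k ≤ p`; what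
remains can be divided by `x`. -/
theorem dvd_of_pow_dvd_sum {R ι : Type*} [CommRing R] [IsDomain R] [Fintype ι] {x : R}
    (hx : x ≠ 0) {e : ι → R}
    (h : ∀ c : ι → R, x ∣ ∑ j, c j ^ p * e j → ∀ j, x ∣ c j) {k : ℕ} (hk : k ≤ p)
    (c : ℕ → ι → R) (hc : x ^ k ∣ ∑ i ∈ Finset.range k, x ^ i * ∑ j, c i j ^ p * e j) :
    ∀ i < k, ∀ j, x ∣ c i j := by
  induction k generalizing c with
  | zero => simp
  | succ k ih =>
    have hsum : ∑ i ∈ Finset.range (k + 1), x ^ i * ∑ j, c i j ^ p * e j =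
        x * (∑ i ∈ Finset.range k, x ^ i * ∑ j, c (i + 1) j ^ p * e j) + ∑ j, c 0 j ^ p * e j := by
      rw [Finset.sum_range_succ', Finset.mul_sum (Finset.range k)]
      simp only [pow_succ', mul_assoc, pow_zero, one_mul]
    rw [hsum] at hc
    have h0 : ∀ j, x ∣ c 0 j := h _ ((dvd_add_right (dvd_mul_right x _)).1
      ((dvd_pow_self x k.succ_ne_zero).trans hc))
    have h0' : x ^ (k + 1) ∣ ∑ j, c 0 j ^ p * e j := Finset.dvd_sum fun j _ =>
      ((pow_dvd_pow x hk).trans (pow_dvd_pow_of_dvd (h0 j) p)).mul_right _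
    have h1 := (dvd_add_left h0').1 hc
    rw [pow_succ', mul_dvd_mul_iff_left hx] at h1
    rintro (_ | i) hi
    · exact h0
    · exact ih (by lia) (fun i => c (i + 1)) h1 i (by lia)

/-- Descent: all coefficients are divisible by `x`, so `x ^ p` factors out of the relation and the
quotients satisfy it again. -/
theorem pow_dvd_of_sum_eq_zero {R ι : Type*} [CommRing R] [IsDomain R] [Fintype ι] {x : R}
    (hx : x ≠ 0) {e : ι → R}
    (h : ∀ c : ι → R, x ∣ ∑ j, c j ^ p * e j → ∀ j, x ∣ c j) (N : ℕ) (c : ℕ → ι → R)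
    (hc : ∑ i ∈ Finset.range p, x ^ i * ∑ j, c i j ^ p * e j = 0) :
    ∀ i < p, ∀ j, x ^ N ∣ c i j := by
  induction N generalizing c with
  | zero => simp
  | succ N ih =>
    have hd := dvd_of_pow_dvd_sum p hx h le_rfl c (hc ▸ dvd_zero _)
    choose! d hd using hd
    have hz : x ^ p * ∑ i ∈ Finset.range p, x ^ i * ∑ j, d i j ^ p * e j = 0 := by
      rw [← hc, Finset.mul_sum]
      refine Finset.sum_congr rfl fun i hi => ?_
      rw [mul_left_comm, Finset.mul_sum]
      congr 1
      refine Finset.sum_congr rfl fun j _ => ?_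
      rw [hd i (Finset.mem_range.1 hi) j]
      ring
    have := ih d ((mul_eq_zero.1 hz).resolve_left (pow_ne_zero p hx))
    intro i hi j
    rw [hd i hi j, pow_succ']
    exact mul_dvd_mul_left x (this i hi j)

variable {p}

/-- If the `e j` lift a basis modulo `x`, the products `x ^ i * e j` with `i < p` form a basis.
Independence follows from descent and Krull's intersection theorem, spanning from Nakayama, since `x
^ p * s` is `x • s`. -/
theorem free_of_quotient [ExpChar R p] [IsDomain R] [IsLocalRing R] [IsNoetherianRing R]
    {x : R} (hxm : x ∈ maximalIdeal R) (hx : x ≠ 0) [ExpChar (R ⧸ Ideal.span {x}) p]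
    [Module.Finite R (FrobeniusPushforward p R)]
    [Module.Finite (R ⧸ Ideal.span {x}) (FrobeniusPushforward p (R ⧸ Ideal.span {x}))]
    [Module.Free (R ⧸ Ideal.span {x}) (FrobeniusPushforward p (R ⧸ Ideal.span {x}))] :
    Module.Free R (FrobeniusPushforward p R) := by
  have hne : Ideal.span {x} ≠ ⊤ := ne_top_of_le_ne_top (maximalIdeal.isMaximal R).ne_top
    ((Ideal.span_singleton_le_iff_mem _).2 hxm)
  have : Nontrivial (R ⧸ Ideal.span {x}) := Ideal.Quotient.nontrivial_iff.2 hne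
  obtain ⟨n, ⟨b⟩⟩ : ∃ n, Nonempty (Module.Basis (Fin n) (R ⧸ Ideal.span {x})
    (FrobeniusPushforward p (R ⧸ Ideal.span {x}))) := ⟨_, ⟨Module.finBasis _ _⟩⟩
  have hmk := Ideal.Quotient.mk_surjective (I := Ideal.span {x})
  choose e he using fun j => hmk ((of p).symm (b j))
  have hdvd : ∀ r : R, x ∣ r ↔ Ideal.Quotient.mk (Ideal.span {x}) r = 0 := fun r => by
    rw [Ideal.Quotient.eq_zero_iff_mem, Ideal.mem_span_singleton]
  have hmap : ∀ c : Fin n → R, of p (Ideal.Quotient.mk (Ideal.span {x}) (∑ j, c j ^ p * e j)) =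
      ∑ j, Ideal.Quotient.mk (Ideal.span {x}) (c j) • b j := fun c => by
    rw [map_sum, map_sum]
    refine Finset.sum_congr rfl fun j _ => ?_
    rw [map_mul, map_pow, he, ← smul_of, AddEquiv.apply_symm_apply]
  have h1 : ∀ r, ∃ (c : Fin n → R) (s : R), r = ∑ j, c j ^ p * e j + x * s := fun r => by
    choose c hc using fun j => hmk (b.repr (of p (Ideal.Quotient.mk _ r)) j)
    obtain ⟨s, hs⟩ : x ∣ r - ∑ j, c j ^ p * e j := by
      rw [hdvd, map_sub, sub_eq_zero]
      apply (of p).injective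
      rw [hmap]
      simp_rw [hc]
      exact (b.sum_repr _).symm
    exact ⟨c, s, by rw [← hs]; ring⟩
  have h2 : ∀ c : Fin n → R, x ∣ ∑ j, c j ^ p * e j → ∀ j, x ∣ c j := fun c hc j => by
    rw [hdvd] at hc ⊢
    have := hmap c
    rw [hc, map_zero] at this
    exact Fintype.linearIndependent_iff.1 b.linearIndependent _ this.symm j
  let v := fun a : Fin p × Fin n => of p (x ^ (a.1 : ℕ) * e a.2)
  have hv : ∀ c : Fin p × Fin n → R, ∑ a, c a • v a =
      of p (∑ i : Fin p, x ^ (i : ℕ) * ∑ j, c (i, j) ^ p * e j) := fun c => by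
    simp_rw [v, smul_of, ← map_sum, Fintype.sum_prod_type, Finset.mul_sum, mul_left_comm]
  refine Module.Free.of_basis (Module.Basis.mk (v := v) ?_ ?_)
  · refine Fintype.linearIndependent_iff.2 fun c hc a => ?_
    rw [hv, EmbeddingLike.map_eq_zero_iff] at hc
    have key := fun N => pow_dvd_of_sum_eq_zero p hx h2 N
      (fun i j => if h : i < p then c (⟨i, h⟩, j) else 0)
      (by rw [← hc, Finset.sum_range]; simp) a.1 a.1.2 a.2
    simp only [Fin.is_lt, dite_true] at key
    have hbot : c a ∈ ⨅ N, Ideal.span {x} ^ N := (Submodule.mem_iInf _).2 fun N => by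
      rw [Ideal.span_singleton_pow, Ideal.mem_span_singleton]
      exact key N
    rwa [Ideal.iInf_pow_eq_bot_of_isLocalRing _ hne] at hbot
  · refine Submodule.le_of_le_smul_of_le_jacobson_bot (I := Ideal.span {x}) Module.Finite.fg_top
      (((Ideal.span_singleton_le_iff_mem _).2 hxm).trans (maximalIdeal_le_jacobson _))
      fun r _ => ?_
    obtain ⟨c, s, hr⟩ := exists_sum_add_pow_mul p h1 p ((of p).symm r)
    have hr' : r = ∑ a : Fin p × Fin n, c a.1 a.2 • v a + x • of p s := by
      rw [hv, smul_of, ← map_add, ← AddEquiv.symm_apply_eq, hr, Finset.sum_range]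
    rw [hr']
    refine add_mem (Submodule.mem_sup_left (sum_mem fun a _ => ?_)) (Submodule.mem_sup_right ?_)
    · exact Submodule.smul_mem _ _ (Submodule.subset_span ⟨a, rfl⟩)
    · exact Submodule.smul_mem_smul (Ideal.mem_span_singleton_self x) trivial

theorem finite_of_isLocalization [ExpChar R p] (M : Submonoid R) (S : Type*) [CommRing S]
    [Algebra R S] [IsLocalization M S] [ExpChar S p] (hF : (frobenius R p).Finite) :
    (frobenius S p).Finite := by
  classical
  obtain ⟨s, hs⟩ := ((finite_iff p).1 hF).fg_top
  refine (finite_iff p).2 ⟨s.image fun a => of p (algebraMap R S ((of p).symm a)), ?_⟩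
  have hmem : ∀ a : FrobeniusPushforward p R, of p (algebraMap R S ((of p).symm a)) ∈
      Submodule.span S (s.image fun a => of p (algebraMap R S ((of p).symm a)) : Set _) := by
    intro a
    induction (hs ▸ trivial : a ∈ Submodule.span R (s : Set (FrobeniusPushforward p R)))
      using Submodule.span_induction with
    | mem a ha => exact Submodule.subset_span (by simpa using ⟨a, ha, rfl⟩)
    | zero => simp
    | add a b _ _ ha hb => simpa using add_mem ha hb
    | smul r a _ ha =>
      have : of p (algebraMap R S ((of p).symm (r • a))) =
          algebraMap R S r • of p (algebraMap R S ((of p).symm a)) := by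
        rw [smul_of, ← map_pow, ← map_mul]
        rfl
      exact this ▸ Submodule.smul_mem _ _ ha
  refine eq_top_iff.2 fun y _ => ?_
  obtain ⟨r, t, hrt⟩ := IsLocalization.exists_mk'_eq M ((of p).symm y)
  -- The denominator becomes a `p`-th power: `r / t = (1 / t) ^ p * (r * t ^ (p - 1))`.
  have : y = IsLocalization.mk' S 1 t • of p (algebraMap R S ((of p).symm
      (of p (r * (t : R) ^ (p - 1))))) := by
    have hu : IsLocalization.mk' S 1 t * algebraMap R S t = 1 := by
      rw [IsLocalization.mk'_spec, map_one]
    rw [smul_of, AddEquiv.symm_apply_apply, ← AddEquiv.symm_apply_eq, ← hrt,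
      IsLocalization.mk'_eq_mul_mk'_one, map_mul, map_pow]
    obtain ⟨n, rfl⟩ : ∃ n, p = n + 1 := ⟨p - 1, by have := expChar_pos R p; lia⟩
    calc _ = algebraMap R S r * IsLocalization.mk' S 1 t *
          (IsLocalization.mk' S 1 t * algebraMap R S t) ^ n := by rw [hu]; ring
      _ = _ := by rw [Nat.add_sub_cancel]; ring
  exact this ▸ Submodule.smul_mem _ _ (hmem _)

end FrobeniusPushforward

/-! ### Kunz's theorem. -/

open FrobeniusPushforward IsLocalRing

/-- Kunz's theorem for `F`-finite regular local rings. -/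
theorem IsRegularLocalRing.free_frobeniusPushforward (R : Type*) [CommRing R]
    [IsRegularLocalRing R] (p : ℕ) [Fact p.Prime] [CharP R p] (hF : (frobenius R p).Finite) :
    Module.Free R (FrobeniusPushforward p R) := by
  induction hn : (maximalIdeal R).spanFinrank generalizing R with
  | zero =>
    have hbot := (Submodule.spanFinrank_eq_zero_iff_eq_bot
      (maximalIdeal R).fg_of_isNoetherianRing).1 hn
    let := (isField_iff_maximalIdeal_eq.2 hbot).toField
    exact Module.Free.of_divisionRing R _
  | succ n ih =>
    obtain ⟨x, hx, hx2, -⟩ := exists_notMem_sq (R := R) (by lia)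
    obtain ⟨_, hrank⟩ := quotient_span_singleton hx hx2
    have := isDomain R
    have : CharP (R ⧸ Ideal.span {x}) p :=
      (CharP.charP_iff_prime_eq_zero Fact.out).2 (by
        rw [← map_natCast (Ideal.Quotient.mk (Ideal.span {x})), CharP.cast_eq_zero, map_zero])
    have hF' : (frobenius (R ⧸ Ideal.span {x}) p).Finite := by
      refine RingHom.Finite.of_comp_finite (f := Ideal.Quotient.mk _) ?_
      rw [← RingHom.frobenius_comm]
      exact (RingHom.Finite.of_surjective _ Ideal.Quotient.mk_surjective).comp hF
    have := ih (R ⧸ Ideal.span {x}) hF' (by lia)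
    have := (finite_iff p).1 hF
    have := (finite_iff p).1 hF'
    exact free_of_quotient hx (by rintro rfl; exact hx2 (zero_mem _))

/-- Kunz's theorem for `F`-finite regular rings. -/
theorem IsRegularRing.flat_frobenius (R : Type*) [CommRing R]
    [IsRegularRing R] (p : ℕ) [Fact p.Prime] [CharP R p] (hF : (frobenius R p).Finite) :
    (frobenius R p).Flat := by
  refine RingHom.Flat.ofLocalizationPrime _ fun J hJ => ?_
  have hcomap : J.comap (frobenius R p) = J := by
    ext r
    rw [Ideal.mem_comap, frobenius_def, hJ.pow_mem_iff_mem _ (Nat.Prime.pos Fact.out)]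
  have : CharP (Localization.AtPrime J) p :=
    (CharP.charP_iff_prime_eq_zero Fact.out).2 (by
      rw [← map_natCast (algebraMap R _), CharP.cast_eq_zero, map_zero])
  have hF' : (frobenius (Localization.AtPrime J) p).Finite := finite_of_isLocalization J.primeCompl _ hF
  have hfree := IsRegularLocalRing.free_frobeniusPushforward (Localization.AtPrime J) p hF'
  have hflat : (frobenius (Localization.AtPrime J) p).Flat := (flat_iff p).2 inferInstance
  -- A variable `I` allows substitution: the source ring depends on the ideal, and `J.comap` equals
  -- `J` only propositionally.
  have key : ∀ (I : Ideal R) [I.IsPrime] (h : I = J.comap (frobenius R p)) (h' : I = J),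
      (Localization.localRingHom I J (frobenius R p) h).Flat := by
    rintro I _ h rfl
    convert hflat
    refine IsLocalization.ringHom_ext I.primeCompl (RingHom.ext fun r => ?_)
    simp [frobenius_def, Localization.localRingHom_to_map]
  exact key _ rfl hcomap

namespace FrobeniusPowers

/-! ### Arithmetic of integral Frobenius powers. -/

section Basic

variable {R : Type*} [CommRing R] {p : ℕ}

theorem bracketPow_mono {a b : Ideal R} (h : a ≤ b) (q : ℕ) : bracketPow a q ≤ bracketPow b q :=
  Ideal.span_mono (Set.image_mono h)

theorem pow_mem_bracketPow {a : Ideal R} {u : R} (h : u ∈ a) (q : ℕ) : u ^ q ∈ bracketPow a q :=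
  Ideal.subset_span ⟨u, h, rfl⟩

theorem bracketPow_le_pow (a : Ideal R) (q : ℕ) : bracketPow a q ≤ a ^ q :=
  Ideal.span_le.2 (by rintro _ ⟨u, hu, rfl⟩; exact Ideal.pow_mem_pow hu q)

theorem bracketPow_one (a : Ideal R) : bracketPow a 1 = a := by
  simp [bracketPow]

theorem intPow_zero (a : Ideal R) : intPow p a 0 = 1 := by
  simp [intPow, bracketPow_one]

theorem intPow_mono {a b : Ideal R} (h : a ≤ b) (k : ℕ) : intPow p a k ≤ intPow p b k :=
  Finset.prod_le_prod' fun _ _ => bracketPow_mono (Ideal.pow_right_mono h _) _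

variable [ExpChar R p]

theorem bracketPow_eq_map (a : Ideal R) (e : ℕ) :
    bracketPow a (p ^ e) = a.map (iterateFrobenius R p e) := rfl

theorem bracketPow_mul (a b : Ideal R) (e : ℕ) :
    bracketPow (a * b) (p ^ e) = bracketPow a (p ^ e) * bracketPow b (p ^ e) := by
  simp_rw [bracketPow_eq_map, Ideal.map_mul]

theorem bracketPow_ideal_one (e : ℕ) : bracketPow (1 : Ideal R) (p ^ e) = 1 := by
  simp_rw [bracketPow_eq_map, Ideal.one_eq_top, Ideal.map_top]

theorem bracketPow_prod {ι : Type*} (s : Finset ι) (a : ι → Ideal R) (e : ℕ) :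
    bracketPow (∏ i ∈ s, a i) (p ^ e) = ∏ i ∈ s, bracketPow (a i) (p ^ e) := by
  classical
  induction s using Finset.induction_on with
  | empty => simpa using bracketPow_ideal_one e
  | insert i s hi ih => rw [Finset.prod_insert hi, Finset.prod_insert hi, bracketPow_mul, ih]

theorem bracketPow_bracketPow (a : Ideal R) (i j : ℕ) :
    bracketPow (bracketPow a (p ^ i)) (p ^ j) = bracketPow a (p ^ (i + j)) := by
  simp_rw [bracketPow_eq_map, Ideal.map_map]
  congr 1
  ext r
  simp [iterateFrobenius_def, pow_add, pow_mul]

theorem bracketPow_span_singleton (f : R) (e : ℕ) :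
    bracketPow (Ideal.span {f}) (p ^ e) = Ideal.span {f ^ p ^ e} := by
  rw [bracketPow_eq_map, Ideal.map_span, Set.image_singleton, iterateFrobenius_def]

theorem bracketPow_le (a : Ideal R) (e : ℕ) : bracketPow a (p ^ e) ≤ a :=
  (bracketPow_le_pow a _).trans (Ideal.pow_le_self (pow_pos (expChar_pos R p) e).ne')

theorem intPow_eq_prod (hp : 1 < p) (a : Ideal R) {k N : ℕ} (h : k ≤ N) :
    intPow p a k = ∏ j ∈ Finset.range (N + 1), bracketPow (a ^ (k / p ^ j % p)) (p ^ j) := by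
  refine Finset.prod_subset (Finset.range_mono (by lia)) fun j _ hj => ?_
  have hj' : k < p ^ j := lt_of_lt_of_le (by simpa using hj) (Nat.lt_pow_self hp).le
  rw [Nat.div_eq_of_lt hj', Nat.zero_mod, pow_zero, bracketPow_ideal_one]

/-- Splitting off the last base `p` digit of the exponent. -/
theorem intPow_eq (hp : 1 < p) (a : Ideal R) (k : ℕ) :
    intPow p a k = a ^ (k % p) * bracketPow (intPow p a (k / p)) p := by
  have hprod := bracketPow_prod (p := p) (Finset.range (k + 1))
    (fun j => bracketPow (a ^ (k / p / p ^ j % p)) (p ^ j)) 1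
  simp_rw [bracketPow_bracketPow, pow_one] at hprod
  rw [intPow_eq_prod hp a k.le_succ, intPow_eq_prod hp a (k.div_le_self p), hprod,
    Finset.prod_range_succ', mul_comm]
  simp [bracketPow_one, Nat.div_div_eq_div_mul, pow_succ']

theorem intPow_mul_pow (hp : 1 < p) (a : Ideal R) (k e : ℕ) :
    intPow p a (k * p ^ e) = bracketPow (intPow p a k) (p ^ e) := by
  induction e with
  | zero => simp [bracketPow_one]
  | succ e ih =>
    rw [intPow_eq hp, pow_succ, ← mul_assoc, Nat.mul_mod_left, Nat.mul_div_cancel _ (by lia), ih,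
      pow_zero, one_mul, ← pow_succ, ← bracketPow_bracketPow, pow_one]

theorem intPow_mul_pow_add_one (hp : 1 < p) (a : Ideal R) (k e : ℕ) :
    intPow p a (k * p ^ (e + 1) + 1) = a * bracketPow (intPow p a k) (p ^ (e + 1)) := by
  rw [intPow_eq hp, pow_succ, ← mul_assoc, Nat.mul_add_mod', Nat.mod_eq_of_lt hp, mul_comm _ p,
    Nat.mul_add_div (by lia), Nat.div_eq_of_lt hp, add_zero, intPow_mul_pow hp,
    pow_one, ← pow_succ, ← bracketPow_bracketPow, pow_one]

/-- Without a carry in base `p` this is an equality. With a carry, induct on `k / p` and use `a^[p]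
⊆ a^p`. -/
theorem intPow_succ_le_mul (hp : 1 < p) (a : Ideal R) (k : ℕ) :
    intPow p a (k + 1) ≤ a * intPow p a k := by
  induction k using Nat.strong_induction_on with
  | _ k ih =>
    have hk := Nat.div_add_mod k p
    have hlt := Nat.mod_lt k (by lia : 0 < p)
    rw [intPow_eq hp a k, intPow_eq hp a (k + 1), ← mul_assoc, ← pow_succ']
    rcases (Nat.succ_le_of_lt hlt).lt_or_eq with h | h
    · have h1 : (k + 1) % p = k % p + 1 := by
        conv_lhs => rw [← hk, add_assoc, Nat.mul_add_mod, Nat.mod_eq_of_lt h]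
      have h2 : (k + 1) / p = k / p := by
        conv_lhs => rw [← hk, add_assoc, Nat.mul_add_div (by lia), Nat.div_eq_of_lt h, add_zero]
      rw [h1, h2]
    · have h0 : k + 1 = p * (k / p + 1) := by rw [mul_add, mul_one]; lia
      have h1 : (k + 1) % p = 0 := by rw [h0, Nat.mul_mod_right]
      have h2 : (k + 1) / p = k / p + 1 := by rw [h0, Nat.mul_div_cancel_left _ (by lia)]
      rw [h1, h2, pow_zero, one_mul]
      have hlt' : k / p < k := by
        refine Nat.div_lt_self (Nat.pos_of_ne_zero ?_) hp
        rintro rfl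
        rw [Nat.zero_mod] at h
        lia
      refine (bracketPow_mono (ih _ hlt') p).trans ?_
      have hmul := bracketPow_mul (p := p) a (intPow p a (k / p)) 1
      rw [pow_one] at hmul
      rw [hmul]
      exact Ideal.mul_mono_left ((bracketPow_le_pow a p).trans (Ideal.pow_le_pow_right h.le))

theorem intPow_antitone (hp : 1 < p) (a : Ideal R) : Antitone (intPow p a) :=
  antitone_nat_of_succ_le fun k => (intPow_succ_le_mul hp a k).trans Ideal.mul_le_right

theorem intPow_le_pow (hp : 1 < p) (a : Ideal R) (k : ℕ) : intPow p a k ≤ a ^ k := by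
  induction k with
  | zero => simp [intPow_zero]
  | succ k ih =>
    rw [pow_succ']
    exact (intPow_succ_le_mul hp a k).trans (Ideal.mul_mono_right ih)

theorem intPow_span_singleton (hp : 1 < p) (f : R) (k : ℕ) :
    intPow p (Ideal.span {f}) k = Ideal.span {f} ^ k := by
  induction k using Nat.strong_induction_on with
  | _ k ih =>
    rcases k.eq_zero_or_pos with rfl | hk
    · simp [intPow_zero]
    · have := bracketPow_span_singleton (p := p) (f ^ (k / p)) 1
      rw [pow_one] at this
      rw [intPow_eq hp, ih _ (Nat.div_lt_self hk hp)]
      simp_rw [Ideal.span_singleton_pow]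
      rw [this, Ideal.span_singleton_mul_span_singleton, ← pow_mul, ← pow_add,
        mul_comm (k / p), Nat.mod_add_div]

end Basic

/-! ### Dual bases, Frobenius roots and colons. -/

section DualBasis

variable {R : Type*} [CommRing R]

/-- `R`, as a module over itself through the `q`-th power map, has a finite dual basis. -/
def HasFrobeniusDualBasis (R : Type*) [CommRing R] (q : ℕ) : Prop :=
  ∃ (ι : Type) (_ : Fintype ι) (φ : ι → R →+ R) (m : ι → R),
    (∀ i s r, φ i (s ^ q * r) = s * φ i r) ∧ ∀ r, r = ∑ i, φ i r ^ q * m i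

/-- The pushforward is finitely presented and flat, hence a summand of some `R^n`; the coordinates
of the inclusion are the `φ i`. -/
theorem hasFrobeniusDualBasis_of_flat {p : ℕ} [ExpChar R p] [IsNoetherianRing R]
    (hfin : (frobenius R p).Finite) (hflat : (frobenius R p).Flat) : HasFrobeniusDualBasis R p := by
  have : Module.Finite R (FrobeniusPushforward p R) := hfin
  have : Module.Flat R (FrobeniusPushforward p R) := hflat
  have : Module.FinitePresentation R (FrobeniusPushforward p R) :=
    Module.finitePresentation_of_finite R _
  have : Module.Projective R (FrobeniusPushforward p R) :=
    Module.Flat.projective_of_finitePresentation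
  obtain ⟨n, f, g, -, -, hfg⟩ :=
    Module.Finite.exists_comp_eq_id_of_projective R (FrobeniusPushforward p R)
  refine ⟨Fin n, inferInstance, fun i => AddMonoidHom.mk' (fun r => g (.of p r) i) fun r s => ?_,
    fun i => (FrobeniusPushforward.of p).symm (f (Pi.single i 1)), fun i s r => ?_, fun r => ?_⟩
  · simp
  · have : g (.of p (s ^ p * r)) i = s * g (.of p r) i := by
      rw [← FrobeniusPushforward.smul_of, map_smul]; rfl
    exact this
  · have h := LinearMap.congr_fun hfg (.of p r)
    rw [LinearMap.comp_apply, LinearMap.pi_apply_eq_sum_univ f] at h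
    refine h.symm.trans (Finset.sum_congr rfl fun i _ => ?_)
    have : (fun j => if i = j then (1 : R) else 0) = Pi.single i 1 := by
      ext j; simp [Pi.single_apply, eq_comm]
    rw [this]
    rfl

theorem HasFrobeniusDualBasis.pow {p : ℕ} [ExpChar R p] (h : HasFrobeniusDualBasis R p) (e : ℕ) :
    HasFrobeniusDualBasis R (p ^ e) := by
  induction e with
  | zero => exact ⟨Unit, inferInstance, fun _ => .id R, 1, by simp, by simp⟩
  | succ e ih =>
    obtain ⟨ι, _, φ, m, hφ, hm⟩ := h
    obtain ⟨κ, _, ψ, n, hψ, hn⟩ := ih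
    refine ⟨κ × ι, inferInstance, fun a => (φ a.2).comp (ψ a.1), fun a => m a.2 ^ p ^ e * n a.1,
      fun a s r => ?_, fun r => ?_⟩
    · rw [AddMonoidHom.comp_apply, pow_succ', pow_mul, hψ, hφ, AddMonoidHom.comp_apply]
    · conv_lhs => rw [hn r]
      rw [Fintype.sum_prod_type]
      refine Finset.sum_congr rfl fun j _ => ?_
      conv_lhs => rw [hm (ψ j r)]
      rw [sum_pow_char_pow p, Finset.sum_mul]
      refine Finset.sum_congr rfl fun i _ => ?_
      rw [AddMonoidHom.comp_apply, mul_pow, ← pow_mul, ← pow_succ', mul_assoc]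

theorem mem_bracketPow_iff {q : ℕ} {ι : Type} [Fintype ι] {φ : ι → R →+ R} {m : ι → R}
    (hφ : ∀ i s r, φ i (s ^ q * r) = s * φ i r) (hm : ∀ r, r = ∑ i, φ i r ^ q * m i)
    {c : Ideal R} {r : R} : r ∈ bracketPow c q ↔ ∀ i, φ i r ∈ c := by
  constructor
  · intro h i
    -- All multiples are needed for the induction: `φ i` is not `R`-linear.
    suffices ∀ a, φ i (a * r) ∈ c by simpa using this 1
    induction h using Submodule.span_induction with
    | mem x hx =>
      obtain ⟨u, hu, rfl⟩ := hx
      intro a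
      change φ i (a * u ^ q) ∈ c
      rw [mul_comm, hφ]
      exact c.mul_mem_right _ hu
    | zero => simp
    | add x y _ _ hx hy => intro a; rw [mul_add, map_add]; exact add_mem (hx a) (hy a)
    | smul s x _ hx => intro a; rw [smul_eq_mul, ← mul_assoc]; exact hx _
  · intro h
    rw [hm r]
    exact sum_mem fun i _ => Ideal.mul_mem_right _ _ (pow_mem_bracketPow (h i) q)

theorem HasFrobeniusDualBasis.le_bracketPow_rootPow {q : ℕ} (h : HasFrobeniusDualBasis R q)
    (c : Ideal R) : c ≤ bracketPow (rootPow c q) q := by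
  obtain ⟨ι, _, φ, m, hφ, hm⟩ := h
  intro r hr
  refine (mem_bracketPow_iff hφ hm).2 fun i => Submodule.mem_sInf.2 fun d hd => ?_
  exact (mem_bracketPow_iff hφ hm).1 (hd hr) i

theorem HasFrobeniusDualBasis.rootPow_le_iff {q : ℕ} (h : HasFrobeniusDualBasis R q)
    {c d : Ideal R} : rootPow c q ≤ d ↔ c ≤ bracketPow d q :=
  ⟨fun hle => (h.le_bracketPow_rootPow c).trans (bracketPow_mono hle q), fun hle => sInf_le hle⟩

theorem HasFrobeniusDualBasis.mem_bracketPow_colon {q : ℕ} (h : HasFrobeniusDualBasis R q)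
    {d : Ideal R} {u r : R} :
    r ∈ bracketPow (d.colon {u}) q ↔ u ^ q * r ∈ bracketPow d q := by
  obtain ⟨ι, _, φ, m, hφ, hm⟩ := h
  rw [mem_bracketPow_iff hφ hm, mem_bracketPow_iff hφ hm]
  refine forall_congr' fun i => ?_
  rw [hφ, Submodule.mem_colon_singleton, smul_eq_mul, mul_comm]

/-- For `u ∈ a`, the colon formula puts `1` in `(b : u)^[q] ⊆ (b : u)`. -/
theorem HasFrobeniusDualBasis.le_of_bracketPow_le {p e : ℕ} [ExpChar R p]
    (h : HasFrobeniusDualBasis R (p ^ e)) {a b : Ideal R}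
    (hab : bracketPow a (p ^ e) ≤ bracketPow b (p ^ e)) : a ≤ b := by
  intro u hu
  have h1 : (1 : R) ∈ bracketPow (b.colon {u}) (p ^ e) :=
    h.mem_bracketPow_colon.2 (by simpa using hab (pow_mem_bracketPow hu _))
  simpa using Submodule.mem_colon_singleton.1 (bracketPow_le _ e h1)

/-- Otherwise, for `u ∈ c` outside `d`, a nonzero `f ∈ a` lies in every `(d : u)^[q]` with `q > 1`,
hence in every power of a proper ideal. -/
theorem HasFrobeniusDualBasis.exists_not_mul_bracketPow_le {p : ℕ} [ExpChar R p] (hp : 1 < p)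
    [IsDomain R] [IsNoetherianRing R] (h : HasFrobeniusDualBasis R p) {a c d : Ideal R}
    (ha : a ≠ ⊥) (hcd : ¬ c ≤ d) :
    ∃ e, ¬ a * bracketPow c (p ^ (e + 1)) ≤ bracketPow d (p ^ (e + 1)) := by
  by_contra! H
  obtain ⟨u, hu, hud⟩ := Set.not_subset.1 hcd
  obtain ⟨f, hf, hf0⟩ := Submodule.exists_mem_ne_zero_of_ne_bot ha
  have hne : d.colon {u} ≠ ⊤ := fun htop => hud <| by
    have := Submodule.mem_colon_singleton.1 (htop ▸ Submodule.mem_top (x := (1 : R)))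
    rwa [one_smul] at this
  refine hf0 ?_
  have hmem : f ∈ ⨅ e, d.colon {u} ^ e := (Submodule.mem_iInf _).2 fun e => by
    have h1 : f ∈ bracketPow (d.colon {u}) (p ^ (e + 1)) := (h.pow _).mem_bracketPow_colon.2 <| by
      rw [mul_comm]
      exact H e (Ideal.mul_mem_mul hf (pow_mem_bracketPow hu _))
    exact Ideal.pow_le_pow_right (e.le_succ.trans (Nat.lt_pow_self hp).le)
      (bracketPow_le_pow _ _ h1)
  rwa [Ideal.iInf_pow_eq_bot_of_isDomain _ hne] at hmem

end DualBasis

end FrobeniusPowers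

namespace FrobeniusPowers

/-! ### Sequences scaled by powers of `p`. -/

section Sequences

variable {p : ℕ} {m : ℕ → ℕ}

theorem div_pow_le_div_pow_iff (hp : 0 < p) {i j k l : ℕ} :
    (i : ℝ≥0∞) / (p : ℝ≥0∞) ^ k ≤ (j : ℝ≥0∞) / (p : ℝ≥0∞) ^ (k + l) ↔ i * p ^ l ≤ j := by
  have hp0 : (p : ℝ≥0∞) ≠ 0 := by exact_mod_cast hp.ne'
  have hk : (p : ℝ≥0∞) ^ k ≠ 0 := pow_ne_zero _ hp0
  have hk' : (p : ℝ≥0∞) ^ k ≠ ∞ := ENNReal.pow_ne_top (ENNReal.natCast_ne_top p)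
  rw [ENNReal.le_div_iff_mul_le (.inl (pow_ne_zero _ hp0))
    (.inl (ENNReal.pow_ne_top (ENNReal.natCast_ne_top p))), pow_add, ← mul_assoc,
    ENNReal.div_mul_cancel hk hk']
  exact_mod_cast Iff.rfl

theorem monotone_div_pow (hp : 0 < p) (h : ∀ e, m e * p ≤ m (e + 1)) :
    Monotone fun e => (m e : ℝ≥0∞) / (p : ℝ≥0∞) ^ e :=
  monotone_nat_of_le_succ fun e => (div_pow_le_div_pow_iff hp).2 (by simpa using h e)

theorem iSup_div_pow_le (hp : 0 < p) (h : ∀ e, m e * p ≤ m (e + 1))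
    (h' : ∀ e j, m (e + j) < (m e + 1) * p ^ j) (e : ℕ) :
    ⨆ e, (m e : ℝ≥0∞) / (p : ℝ≥0∞) ^ e ≤ ((m e + 1 : ℕ) : ℝ≥0∞) / (p : ℝ≥0∞) ^ e := by
  refine iSup_le fun i => (monotone_div_pow hp h (Nat.le_add_left i e)).trans ?_
  rw [ENNReal.div_le_iff (pow_ne_zero _ (by exact_mod_cast hp.ne'))
    (ENNReal.pow_ne_top (ENNReal.natCast_ne_top p)), pow_add, ← mul_assoc,
    ENNReal.div_mul_cancel (pow_ne_zero _ (by exact_mod_cast hp.ne'))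
    (ENNReal.pow_ne_top (ENNReal.natCast_ne_top p))]
  exact_mod_cast (h' e i).le

theorem div_pow_lt_iSup (hp : 0 < p) (h : ∀ e, ∃ j, m e * p ^ j < m (e + j)) (e : ℕ) :
    (m e : ℝ≥0∞) / (p : ℝ≥0∞) ^ e < ⨆ e, (m e : ℝ≥0∞) / (p : ℝ≥0∞) ^ e := by
  obtain ⟨j, hj⟩ := h e
  refine lt_of_lt_of_le ?_ (le_iSup (fun e => (m e : ℝ≥0∞) / (p : ℝ≥0∞) ^ e) (e + j))
  rw [ENNReal.lt_div_iff_mul_lt (.inl (pow_ne_zero _ (by exact_mod_cast hp.ne')))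
    (.inl (ENNReal.pow_ne_top (ENNReal.natCast_ne_top p))), pow_add, ← mul_assoc,
    ENNReal.div_mul_cancel (pow_ne_zero _ (by exact_mod_cast hp.ne'))
    (ENNReal.pow_ne_top (ENNReal.natCast_ne_top p))]
  exact_mod_cast hj

end Sequences

/-! ### Thresholds and critical exponents. -/

section Exponents

variable {R : Type*} [CommRing R]

theorem isGreatest_sSup_not_le {I : ℕ → Ideal R} {J : Ideal R} (h0 : ¬ I 0 ≤ J)
    (hI : Antitone I) {N : ℕ} (hN : I N ≤ J) :
    IsGreatest {k | ¬ I k ≤ J} (sSup {k | ¬ I k ≤ J}) := by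
  have hbdd : BddAbove {k | ¬ I k ≤ J} :=
    ⟨N, fun k hk => le_of_not_ge fun h => hk ((hI h).trans hN)⟩
  exact ⟨Nat.sSup_mem ⟨0, h0⟩ hbdd, fun k hk => le_csSup hbdd hk⟩

theorem le_iff_lt_of_isGreatest {I : ℕ → Ideal R} {J : Ideal R} (hI : Antitone I) {n : ℕ}
    (hn : IsGreatest {k | ¬ I k ≤ J} n) {k : ℕ} : I k ≤ J ↔ n < k :=
  ⟨fun h => lt_of_not_ge fun hk => hn.1 ((hI hk).trans h),
    fun h => by_contra fun hk => (hn.2 hk).not_gt h⟩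

/-- Pigeonhole on exponents, one generator at a time; the extra `q` covers the empty set. -/
theorem span_pow_card_mul_le_bracketPow {b : Ideal R} {q : ℕ} (hq : q ≠ 0) (s : Finset R)
    (hs : ∀ x ∈ s, x ∈ b) : Ideal.span (s : Set R) ^ ((s.card + 1) * q) ≤ bracketPow b q := by
  classical
  induction s using Finset.induction_on with
  | empty => simp [Ideal.bot_pow hq]
  | insert x s hx ih =>
    rw [Finset.coe_insert, Ideal.span_insert, Finset.card_insert_of_notMem hx, add_mul _ 1,
      one_mul, add_comm]
    refine Ideal.sup_pow_add_le_pow_sup_pow.trans (sup_le ?_ (ih fun y hy => hs y (by simp [hy])))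
    rw [Ideal.span_singleton_pow, Ideal.span_singleton_le_iff_mem]
    exact pow_mem_bracketPow (hs x (by simp)) q

theorem exists_forall_pow_le_bracketPow [IsNoetherianRing R] {a b : Ideal R}
    (hab : a ≤ b.radical) : ∃ C : ℕ, ∀ q ≠ 0, a ^ (C * q) ≤ bracketPow b q := by
  obtain ⟨n, hn⟩ := Ideal.exists_pow_le_of_le_radical_of_fg hab a.fg_of_isNoetherianRing
  obtain ⟨s, hs⟩ := b.fg_of_isNoetherianRing
  refine ⟨n * (s.card + 1), fun q hq => ?_⟩
  rw [mul_assoc, pow_mul]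
  refine (Ideal.pow_right_mono hn _).trans ?_
  conv_lhs => rw [← hs]
  exact span_pow_card_mul_le_bracketPow hq s fun x hx => hs ▸ Ideal.subset_span hx

variable {p : ℕ} [ExpChar R p] {a b : Ideal R}

theorem one_not_le_bracketPow (hb : b ≠ ⊤) (e : ℕ) : ¬ (1 : Ideal R) ≤ bracketPow b (p ^ e) :=
  fun h => hb (top_le_iff.1 ((Ideal.one_eq_top (R := R) ▸ h).trans (bracketPow_le b e)))

theorem ft_span_singleton (hp : 1 < p) (f : R) (b : Ideal R) :
    ft p (Ideal.span {f}) b = crit p (Ideal.span {f}) b := by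
  simp_rw [ft, crit, nu, mu, intPow_span_singleton hp]

variable [IsNoetherianRing R]

theorem isGreatest_nu (hb : b ≠ ⊤) (hab : a ≤ b.radical) (e : ℕ) :
    IsGreatest {k | ¬ a ^ k ≤ bracketPow b (p ^ e)} (nu a b (p ^ e)) := by
  obtain ⟨C, hC⟩ := exists_forall_pow_le_bracketPow hab
  exact isGreatest_sSup_not_le (by rw [pow_zero]; exact one_not_le_bracketPow hb e)
    (fun _ _ => Ideal.pow_le_pow_right) (hC _ (pow_pos (expChar_pos R p) e).ne')

theorem isGreatest_mu (hp : 1 < p) (hb : b ≠ ⊤) (hab : a ≤ b.radical) (e : ℕ) :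
    IsGreatest {k | ¬ intPow p a k ≤ bracketPow b (p ^ e)} (mu p a b (p ^ e)) := by
  obtain ⟨C, hC⟩ := exists_forall_pow_le_bracketPow hab
  exact isGreatest_sSup_not_le (by rw [intPow_zero]; exact one_not_le_bracketPow hb e)
    (intPow_antitone hp a) ((intPow_le_pow hp a _).trans (hC _ (pow_pos (expChar_pos R p) e).ne'))

theorem pow_le_bracketPow_iff (hb : b ≠ ⊤) (hab : a ≤ b.radical) {e k : ℕ} :
    a ^ k ≤ bracketPow b (p ^ e) ↔ nu a b (p ^ e) < k :=
  le_iff_lt_of_isGreatest (fun _ _ => Ideal.pow_le_pow_right) (isGreatest_nu hb hab e)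

theorem intPow_le_bracketPow_iff (hp : 1 < p) (hb : b ≠ ⊤) (hab : a ≤ b.radical) {e k : ℕ} :
    intPow p a k ≤ bracketPow b (p ^ e) ↔ mu p a b (p ^ e) < k :=
  le_iff_lt_of_isGreatest (intPow_antitone hp a) (isGreatest_mu hp hb hab e)

theorem mu_le_nu (hp : 1 < p) (hb : b ≠ ⊤) (hab : a ≤ b.radical) (e : ℕ) :
    mu p a b (p ^ e) ≤ nu a b (p ^ e) :=
  (isGreatest_nu hb hab e).2 fun h =>
    (isGreatest_mu hp hb hab e).1 ((intPow_le_pow hp a _).trans h)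

theorem crit_le_ft (hp : 1 < p) (hb : b ≠ ⊤) (hab : a ≤ b.radical) : crit p a b ≤ ft p a b :=
  iSup_mono fun e => ENNReal.div_le_div_right (by exact_mod_cast mu_le_nu hp hb hab e) _

theorem crit_mono (hp : 1 < p) (hb : b ≠ ⊤) {c : Ideal R} (hca : c ≤ a) (hab : a ≤ b.radical) :
    crit p c b ≤ crit p a b :=
  iSup_mono fun e => ENNReal.div_le_div_right (Nat.cast_le.2 <|
    (isGreatest_mu hp hb hab e).2 fun h =>
      (isGreatest_mu hp hb (hca.trans hab) e).1 ((intPow_mono hca _).trans h)) _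

theorem ft_lt_top (hb : b ≠ ⊤) (hab : a ≤ b.radical) : ft p a b < ∞ := by
  obtain ⟨C, hC⟩ := exists_forall_pow_le_bracketPow hab
  refine lt_of_le_of_lt (iSup_le fun e => ?_) (ENNReal.natCast_lt_top C)
  have hp := expChar_pos R p
  refine ENNReal.div_le_of_le_mul ?_
  exact_mod_cast ((pow_le_bracketPow_iff hb hab).1 (hC _ (pow_pos hp e).ne')).le

/-- If `a^(νp) ⊆ b^[qp]`, then `(a^ν)^[p] ⊆ (b^[q])^[p]`, and Frobenius reflects this inclusion. -/
theorem nu_mul_le (h : HasFrobeniusDualBasis R p) (hb : b ≠ ⊤) (hab : a ≤ b.radical) (e : ℕ) :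
    nu a b (p ^ e) * p ≤ nu a b (p ^ (e + 1)) := by
  refine (isGreatest_nu (p := p) hb hab (e + 1)).2 fun hle => (isGreatest_nu (p := p) hb hab e).1 ?_
  have h' : HasFrobeniusDualBasis R (p ^ 1) := by rwa [pow_one]
  refine HasFrobeniusDualBasis.le_of_bracketPow_le (p := p) (e := 1) h' ?_
  rw [bracketPow_bracketPow, pow_one]
  exact (bracketPow_le_pow (a ^ nu a b (p ^ e)) p).trans (by rwa [← pow_mul])

theorem mu_add_lt (hp : 1 < p) (hb : b ≠ ⊤) (hab : a ≤ b.radical) (e j : ℕ) :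
    mu p a b (p ^ (e + j)) < (mu p a b (p ^ e) + 1) * p ^ j := by
  rw [← intPow_le_bracketPow_iff hp hb hab, intPow_mul_pow hp, ← bracketPow_bracketPow]
  exact bracketPow_mono ((intPow_le_bracketPow_iff hp hb hab).2 (Nat.lt_succ_self _)) _

theorem mu_mul_le (hp : 1 < p) (h : HasFrobeniusDualBasis R p) (hb : b ≠ ⊤) (hab : a ≤ b.radical)
    (e : ℕ) : mu p a b (p ^ e) * p ≤ mu p a b (p ^ (e + 1)) := by
  refine (isGreatest_mu hp hb hab (e + 1)).2 fun hle => (isGreatest_mu hp hb hab e).1 ?_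
  have h' : HasFrobeniusDualBasis R (p ^ 1) := by rwa [pow_one]
  refine HasFrobeniusDualBasis.le_of_bracketPow_le (p := p) (e := 1) h' ?_
  rw [bracketPow_bracketPow, ← intPow_mul_pow hp, pow_one]
  exact hle

theorem exists_mu_mul_pow_lt [IsDomain R] (hp : 1 < p) (h : HasFrobeniusDualBasis R p)
    (ha : a ≠ ⊥) (hb : b ≠ ⊤) (hab : a ≤ b.radical) (e : ℕ) :
    ∃ j, mu p a b (p ^ e) * p ^ j < mu p a b (p ^ (e + j)) := by
  obtain ⟨j, hj⟩ := h.exists_not_mul_bracketPow_le hp ha (isGreatest_mu hp hb hab e).1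
  refine ⟨j + 1, (isGreatest_mu hp hb hab _).2 fun hle => hj ?_⟩
  rw [bracketPow_bracketPow, ← intPow_mul_pow_add_one hp]
  exact hle

theorem div_pow_lt_crit [IsDomain R] (hp : 1 < p) (h : HasFrobeniusDualBasis R p)
    (ha : a ≠ ⊥) (hb : b ≠ ⊤) (hab : a ≤ b.radical) (e : ℕ) :
    (mu p a b (p ^ e) : ℝ≥0∞) / (p : ℝ≥0∞) ^ e < crit p a b :=
  div_pow_lt_iSup (by lia) (exists_mu_mul_pow_lt hp h ha hb hab) e

theorem crit_le_div_pow (hp : 1 < p) (h : HasFrobeniusDualBasis R p)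
    (hb : b ≠ ⊤) (hab : a ≤ b.radical) (e : ℕ) :
    crit p a b ≤ ((mu p a b (p ^ e) + 1 : ℕ) : ℝ≥0∞) / (p : ℝ≥0∞) ^ e :=
  iSup_div_pow_le (m := fun e => mu p a b (p ^ e)) (by lia) (mu_mul_le hp h hb hab)
    (mu_add_lt hp hb hab) e

theorem crit_le_div_pow_iff [IsDomain R] (hp : 1 < p) (h : HasFrobeniusDualBasis R p)
    (ha : a ≠ ⊥) (hb : b ≠ ⊤) (hab : a ≤ b.radical) {k e : ℕ} :
    crit p a b ≤ (k : ℝ≥0∞) / (p : ℝ≥0∞) ^ e ↔ intPow p a k ≤ bracketPow b (p ^ e) := by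
  rw [intPow_le_bracketPow_iff hp hb hab]
  constructor
  · intro hle
    have := (div_pow_lt_crit hp h ha hb hab e).trans_le hle
    by_contra! hk
    exact this.not_ge (ENNReal.div_le_div_right (by exact_mod_cast hk) _)
  · intro hlt
    exact (crit_le_div_pow hp h hb hab e).trans
      (ENNReal.div_le_div_right (by exact_mod_cast hlt) _)

theorem realPow_le_iff [IsDomain R] (hp : 1 < p) (h : HasFrobeniusDualBasis R p)
    (ha : a ≠ ⊥) (hb : b ≠ ⊤) (hab : a ≤ b.radical) {t : ℝ≥0} :
    realPow p a t ≤ b ↔ crit p a b ≤ t := by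
  have hp0 : (p : ℝ≥0) ≠ 0 := by exact_mod_cast (by lia : p ≠ 0)
  have hcast : ∀ k e : ℕ, t ≤ (k : ℝ≥0) / (p : ℝ≥0) ^ e ↔
      (t : ℝ≥0∞) ≤ (k : ℝ≥0∞) / (p : ℝ≥0∞) ^ e := fun k e => by
    rw [← ENNReal.coe_le_coe, ENNReal.coe_div (pow_ne_zero _ hp0)]
    simp
  simp_rw [realPow, iSup_le_iff, ratPow, (h.pow _).rootPow_le_iff, hcast,
    ← crit_le_div_pow_iff hp h ha hb hab]
  constructor
  · intro H
    by_contra! hlt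
    obtain ⟨e, he⟩ := lt_iSup_iff.1 hlt
    -- Some `μ(q)/q` exceeds `t`, so `H` would bound `crit` by it, against strictness.
    exact (div_pow_lt_crit hp h ha hb hab e).not_ge (H _ e he.le)
  · exact fun hle k e hk => hle.trans hk

end Exponents

end FrobeniusPowers

/-! ### The proposition. -/

theorem mainTheorem9 {R : Type*} [CommRing R] [IsDomain R] [IsRegularRing R]
    (p : ℕ) [Fact p.Prime] [CharP R p] (hF : (frobenius R p).Finite)
    (a b : Ideal R) (ha0 : a ≠ ⊥) (ha1 : a ≠ ⊤) (hb0 : b ≠ ⊥) (hb1 : b ≠ ⊤)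
    (hab : a ≤ b.radical) :
    -- the maxima defining `ν` and `μ` exist, and the suprema defining the exponents are limits
    ((∀ e : ℕ, IsGreatest {k : ℕ | ¬ a ^ k ≤ FrobeniusPowers.bracketPow b (p ^ e)}
        (FrobeniusPowers.nu a b (p ^ e))) ∧
      (∀ e : ℕ, IsGreatest
        {k : ℕ | ¬ FrobeniusPowers.intPow p a k ≤ FrobeniusPowers.bracketPow b (p ^ e)}
        (FrobeniusPowers.mu p a b (p ^ e))) ∧
      Tendsto (fun e : ℕ => (FrobeniusPowers.nu a b (p ^ e) : ℝ≥0∞) / (p : ℝ≥0∞) ^ e) atTop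
        (𝓝 (FrobeniusPowers.ft p a b)) ∧
      Tendsto (fun e : ℕ => (FrobeniusPowers.mu p a b (p ^ e) : ℝ≥0∞) / (p : ℝ≥0∞) ^ e) atTop
        (𝓝 (FrobeniusPowers.crit p a b))) ∧
    -- comparison of the exponents, their positivity and finiteness
    (∀ f ∈ a, f ≠ 0 →
      0 < FrobeniusPowers.ft p (Ideal.span {f}) b ∧
      FrobeniusPowers.ft p (Ideal.span {f}) b = FrobeniusPowers.crit p (Ideal.span {f}) b ∧
      FrobeniusPowers.crit p (Ideal.span {f}) b ≤ FrobeniusPowers.crit p a b ∧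
      FrobeniusPowers.crit p a b ≤ FrobeniusPowers.ft p a b ∧
      FrobeniusPowers.ft p a b < ∞) ∧
    -- the critical exponent through integral Frobenius powers
    (FrobeniusPowers.crit p a b =
        sSup {x : ℝ≥0∞ | ∃ i e : ℕ, x = (i : ℝ≥0∞) / (p : ℝ≥0∞) ^ e ∧
          ¬ FrobeniusPowers.intPow p a i ≤ FrobeniusPowers.bracketPow b (p ^ e)} ∧
      FrobeniusPowers.crit p a b =
        sInf {x : ℝ≥0∞ | ∃ i e : ℕ, x = (i : ℝ≥0∞) / (p : ℝ≥0∞) ^ e ∧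
          FrobeniusPowers.intPow p a i ≤ FrobeniusPowers.bracketPow b (p ^ e)}) ∧
    -- the critical exponent through real Frobenius powers
    (FrobeniusPowers.crit p a b =
        sSup {x : ℝ≥0∞ | ∃ t : ℝ≥0, x = (t : ℝ≥0∞) ∧ ¬ FrobeniusPowers.realPow p a t ≤ b} ∧
      IsLeast {x : ℝ≥0∞ | ∃ t : ℝ≥0, x = (t : ℝ≥0∞) ∧ FrobeniusPowers.realPow p a t ≤ b}
        (FrobeniusPowers.crit p a b)) ∧
    -- recovering `μ` from the critical exponent
    (∀ e : ℕ,
      (FrobeniusPowers.mu p a b (p ^ e) : ℝ≥0∞) < (p : ℝ≥0∞) ^ e * FrobeniusPowers.crit p a b ∧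
      (p : ℝ≥0∞) ^ e * FrobeniusPowers.crit p a b ≤
        (FrobeniusPowers.mu p a b (p ^ e) : ℝ≥0∞) + 1 ∧
      (FrobeniusPowers.mu p a b (p ^ e) : ℤ) =
        ⌈(p : ℝ) ^ e * (FrobeniusPowers.crit p a b).toReal⌉ - 1) := by
  have hp : 1 < p := (Fact.out : p.Prime).one_lt
  have hp0 : (p : ℝ≥0∞) ≠ 0 := by exact_mod_cast (by lia : p ≠ 0)
  have hpow0 : ∀ e : ℕ, (p : ℝ≥0∞) ^ e ≠ 0 := fun e => pow_ne_zero e hp0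
  have hpowt : ∀ e : ℕ, (p : ℝ≥0∞) ^ e ≠ ∞ :=
    fun e => ENNReal.pow_ne_top (ENNReal.natCast_ne_top p)
  have h : FrobeniusPowers.HasFrobeniusDualBasis R p :=
    FrobeniusPowers.hasFrobeniusDualBasis_of_flat hF (IsRegularRing.flat_frobenius R p hF)
  have hlim := tendsto_atTop_iSup (FrobeniusPowers.monotone_div_pow
    (m := fun e => FrobeniusPowers.mu p a b (p ^ e)) (by lia)
    (FrobeniusPowers.mu_mul_le hp h hb1 hab))
  have hiff := fun k e : ℕ =>
    FrobeniusPowers.crit_le_div_pow_iff hp h ha0 hb1 hab (k := k) (e := e)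
  have htop : FrobeniusPowers.crit p a b < ∞ :=
    (FrobeniusPowers.crit_le_ft hp hb1 hab).trans_lt (FrobeniusPowers.ft_lt_top hb1 hab)
  have hreal := fun t : ℝ≥0 =>
    FrobeniusPowers.realPow_le_iff hp h ha0 hb1 hab (t := t)
  have hlt : ∀ e : ℕ, (FrobeniusPowers.mu p a b (p ^ e) : ℝ≥0∞) <
      (p : ℝ≥0∞) ^ e * FrobeniusPowers.crit p a b := fun e => by
    rw [mul_comm]
    exact (ENNReal.div_lt_iff (.inl (hpow0 e)) (.inl (hpowt e))).1
      (FrobeniusPowers.div_pow_lt_crit hp h ha0 hb1 hab e)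
  have hle : ∀ e : ℕ, (p : ℝ≥0∞) ^ e * FrobeniusPowers.crit p a b ≤
      (FrobeniusPowers.mu p a b (p ^ e) : ℝ≥0∞) + 1 := fun e => by
    rw [mul_comm]
    exact_mod_cast (ENNReal.le_div_iff_mul_le (.inl (hpow0 e)) (.inl (hpowt e))).1
      (FrobeniusPowers.crit_le_div_pow hp h hb1 hab e)
  refine ⟨⟨FrobeniusPowers.isGreatest_nu hb1 hab, FrobeniusPowers.isGreatest_mu hp hb1 hab,
    tendsto_atTop_iSup (FrobeniusPowers.monotone_div_pow
      (m := fun e => FrobeniusPowers.nu a b (p ^ e)) (by lia)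
      (FrobeniusPowers.nu_mul_le h hb1 hab)), hlim⟩,
    fun f hf hf0 => ?_, ⟨?_, ?_⟩, ⟨?_, ?_, ?_⟩, fun e => ⟨hlt e, hle e, ?_⟩⟩
  · have hfa : Ideal.span {f} ≤ a := (Ideal.span_singleton_le_iff_mem a).2 hf
    have hft := FrobeniusPowers.ft_span_singleton hp f b
    refine ⟨hft ▸ ?_, hft, FrobeniusPowers.crit_mono hp hb1 hfa hab,
      FrobeniusPowers.crit_le_ft hp hb1 hab, FrobeniusPowers.ft_lt_top hb1 hab⟩
    -- Positivity is the strict bound at `q = 1`.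
    exact zero_le.trans_lt (FrobeniusPowers.div_pow_lt_crit hp h
      (by simpa using hf0) hb1 (hfa.trans hab) 0)
  · refine le_antisymm (iSup_le fun e => le_sSup ⟨_, e, rfl,
      (FrobeniusPowers.isGreatest_mu hp hb1 hab e).1⟩) (sSup_le ?_)
    rintro _ ⟨i, e, rfl, hi⟩
    rw [← hiff] at hi
    exact (lt_of_not_ge hi).le
  · refine le_antisymm (le_sInf ?_) ?_
    · rintro _ ⟨i, e, rfl, hi⟩
      exact (hiff i e).2 hi
    -- The values `(μ(q)+1)/q` belong to the set and tend to `crit`, as `1/q → 0`.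
    · have h1 : Tendsto (fun e : ℕ => (FrobeniusPowers.mu p a b (p ^ e) : ℝ≥0∞) / (p : ℝ≥0∞) ^ e +
          (p : ℝ≥0∞)⁻¹ ^ e) atTop (𝓝 (FrobeniusPowers.crit p a b + 0)) :=
        hlim.add (ENNReal.tendsto_pow_atTop_nhds_zero_of_lt_one
          (ENNReal.inv_lt_one.2 (by exact_mod_cast hp)))
      rw [add_zero] at h1
      refine ge_of_tendsto' h1 fun e => sInf_le ⟨FrobeniusPowers.mu p a b (p ^ e) + 1, e, ?_,
        (FrobeniusPowers.intPow_le_bracketPow_iff hp hb1 hab).2 (Nat.lt_succ_self _)⟩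
      rw [Nat.cast_add, ENNReal.add_div, Nat.cast_one, one_div, ENNReal.inv_pow]
  · have hset : {x : ℝ≥0∞ | ∃ t : ℝ≥0, x = (t : ℝ≥0∞) ∧ ¬ FrobeniusPowers.realPow p a t ≤ b} =
        Set.Iio (FrobeniusPowers.crit p a b) := by
      ext x
      constructor
      · rintro ⟨t, rfl, ht⟩
        rw [hreal] at ht
        exact lt_of_not_ge ht
      · intro hx
        lift x to ℝ≥0 using (lt_top_of_lt hx).ne
        exact ⟨x, rfl, by rw [hreal]; exact not_le_of_gt hx⟩
    rw [hset]
    exact isLUB_Iio.sSup_eq.symm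
  · exact ⟨_, (ENNReal.coe_toNNReal htop.ne).symm,
      (hreal _).2 (ENNReal.coe_toNNReal htop.ne).ge⟩
  · rintro _ ⟨t, rfl, ht⟩
    exact (hreal t).1 ht
  · have hne : (p : ℝ≥0∞) ^ e * FrobeniusPowers.crit p a b ≠ ∞ :=
      ENNReal.mul_ne_top (hpowt e) htop.ne
    have h1 := (ENNReal.toReal_lt_toReal (ENNReal.natCast_ne_top _) hne).2 (hlt e)
    have h2 := (ENNReal.toReal_le_toReal hne (by simp)).2 (hle e)
    rw [ENNReal.toReal_add (ENNReal.natCast_ne_top _) ENNReal.one_ne_top] at h2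
    simp only [ENNReal.toReal_mul, ENNReal.toReal_pow, ENNReal.toReal_natCast,
      ENNReal.toReal_one] at h1 h2
    rw [eq_sub_iff_add_eq, eq_comm, Int.ceil_eq_iff]
    push_cast
    exact ⟨by linarith, h2⟩
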